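/- Let $X_1,\dots,X_n$ be i.i.d. $\mathrm{Bernoulli}(p)$ with $p\in[0,1]$. Fix $K>0$, and let $n_1<n_2$ be positive integers with $n_2\le n\le K n_1$. For $f:[0,1]\to\mathbb R$ the general $2$-jackknife estimator is $$\hat f_2=C_1\,\mathbb U_n[f(\hat p_{n_1})]+C_2\,\mathbb U_n[f(\hat p_{n_2})],\qquad C_1=\frac{n_1}{n_1-n_2},\quad C_2=\frac{n_2}{n_2-n_1},$$ where $\mathbb U_n[f(\hat p_q)]$ is the average, over all $\binom nq$ subsets $S\subseteq\{1,\dots,n\}$ of size $q$, of $f\big(\tfrac1q\sum_{i\in S}X_i\big)$. Write $\|\mathbb E_p\hat f_2-f(p)\|=\sup_{p\in[0,1]}|\mathbb E_p\hat f_2-f(p)|$. The delete-$1$ $2$-jackknife is the case $n_2=n$, $n_1=n-1$ (with $n\ge2$). The bounded coefficients condition with parameter $B$ is $|C_1|+|C_2|\le B$. Put $0\ln 0=0$. Upper bounds. For every $K>0$ there is a constant $C>0$, depending only on $K$, such that for every general $2$-jackknife as above: 1. if $f(p)=-p\ln p$, then $\|\mathbb E_p\hat f_2-f(p)\|\le C/n$;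 2. if $f(p)=p^\alpha$ with $0<\alpha<1$, then $\|\mathbb E_p\hat f_2-f(p)\|\le C/n^\alpha$. Lower bounds. There are a constant $c>0$ and, for each $\alpha\in(0,1)$, a constant $c_\alpha>0$ such that for the delete-$1$ $2$-jackknife, for all $n\ge2$: 1. if $f(p)=-p\ln p$, then $\|\mathbb E_p\hat f_2-f(p)\|\ge c/n$; 2. if $f(p)=p^\alpha$ with $0<\alpha<1$, then $\|\mathbb E_p\hat f_2-f(p)\|\ge c_\alpha/n^\alpha$. The same two lower bounds hold for every general $2$-jackknife that satisfies the bounded coefficients condition with parameter $B$, where the constants may also depend on $B$ (but not on $K$, $n$, $n_1$, $n_2$). -/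

import Mathlib

noncomputable section

namespace Jackknife

/-- Expectation `𝔼_p[g(X_1, …, X_n)]` for `X_1, …, X_n` i.i.d. Bernoulli with success
probability `p` (`true` is a success). -/
def bernoulliExp (n : ℕ) (p : ℝ) (g : (Fin n → Bool) → ℝ) : ℝ :=
  ∑ x : Fin n → Bool, (∏ i, if x i = true then p else 1 - p) * g x

/-- Empirical success frequency `p̂` of the subsample with index set `S`. -/
def empFreq {n : ℕ} (x : Fin n → Bool) (S : Finset (Fin n)) : ℝ :=
  ((S.filter fun i => x i = true).card : ℝ) / (S.card : ℝ)

/-- The U-statistic `𝕌_n[f(p̂_q)]`: the average over all subsamples of size `q` of `f` at the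
empirical frequency of the subsample. -/
def uStat (f : ℝ → ℝ) (n q : ℕ) (x : Fin n → Bool) : ℝ :=
  (∑ S ∈ Finset.powersetCard q (Finset.univ : Finset (Fin n)), f (empFreq x S)) /
    (n.choose q : ℝ)

/-- The coefficients `C_i = ∏_{j ≠ i} n_i / (n_i - n_j)`, where `m i` is the sample size `n_i`. -/
def coeff {r : ℕ} (m : Fin r → ℕ) (i : Fin r) : ℝ :=
  ∏ j ∈ Finset.univ.erase i, (m i : ℝ) / ((m i : ℝ) - (m j : ℝ))

/-- The `r`-jackknife estimator `∑ C_i 𝕌_n[f(p̂_{n_i})]` built from `n` samples. -/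
def estimator (f : ℝ → ℝ) (n : ℕ) {r : ℕ} (m : Fin r → ℕ) (x : Fin n → Bool) : ℝ :=
  ∑ i, coeff m i * uStat f n (m i) x

/-- Admissible sample sizes of a general `r`-jackknife with `n` samples and constant `K`:
`1 ≤ n_1 < ⋯ < n_r ≤ n ≤ K n_1`. (As the sizes increase, `n ≤ K n_1` is the same as
`n ≤ K n_i` for every `i`.) -/
structure IsSizes (K : ℝ) (n : ℕ) {r : ℕ} (m : Fin r → ℕ) : Prop where
  one_le : ∀ i, 1 ≤ m i
  strictMono : StrictMono m
  le_n : ∀ i, m i ≤ n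
  n_le : ∀ i, (n : ℝ) ≤ K * (m i : ℝ)

/-- The sample sizes of the delete-`d` jackknife: `n_r = n` and `n_i - n_{i-1} = d`. -/
def IsDelete (d n : ℕ) {r : ℕ} (m : Fin r → ℕ) : Prop :=
  (∀ i : Fin r, (i : ℕ) + 1 = r → m i = n) ∧
    ∀ i j : Fin r, (i : ℕ) + 1 = (j : ℕ) → m j = m i + d

/-- The bounded coefficients condition with parameter `B`. -/
def BoundedCoeff (B : ℝ) {r : ℕ} (m : Fin r → ℕ) : Prop :=
  ∑ i, |coeff m i| ≤ B

/-- The supremum over `p ∈ [0,1]` of `|𝔼_p f̂_r - f(p)|`, as an extended non-negative real. -/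
def biasNorm (f : ℝ → ℝ) (n : ℕ) {r : ℕ} (m : Fin r → ℕ) : ENNReal :=
  ⨆ p ∈ Set.Icc (0 : ℝ) 1, ENNReal.ofReal |bernoulliExp n p (estimator f n m) - f p|

end Jackknife

end

/-!
A `q`-subsample has a binomial number of successes, so the expectation of `𝕌_n[f(p̂_q)]` is the
Bernstein polynomial `B_q f(p) = 𝔼 f(S_q / q)` with `S_q` binomial (`bernoulliExp_uStat`). Writing
`n_1 < n_2` for the sample sizes, the bias of the `2`-jackknife is
`(n_2 B_{n_2} f - n_1 B_{n_1} f) / (n_2 - n_1) - f`, which telescopes into the average over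
`n_1 ≤ k < n_2` of `D_k = (k + 1) B_{k+1} f - k B_k f - f`, the bias with sizes `k` and `k + 1`
(`bias_eq_average`). Every claim thus reduces to a one-sided or two-sided bound on `D_k(p)` that is
uniform in `k`, whatever the size of the coefficients.

Splitting off the last trial turns `D_k` into an expectation of increments under `S = S_k`:

* for the entropy, `D_k = p (ψ(k) - 𝔼 ψ(S) + log p)` with
  `ψ(s) = (s + 1) log (s + 1) - s log s` (`stepBias_entropy`);
* for `x ^ α`, `D_k` is a combination of `𝔼 S ^ α`, `p 𝔼 [(S + 1) ^ α - S ^ α]` and `p ^ α`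
  (`stepBias_rpow`).

These expectations are compared with their values at `S ≈ k p` through tangent-line inequalities,
which are affine in `S` or in `1 / (S + 1)`; both have explicit control, since `𝔼 S = k p` and,
by size bias, `(k + 1) p 𝔼[1 / (S + 1)] ≤ 1` (`binomialExp_inv_succ_le`). The result is
`|D_k| ≤ 2 / k` and `|D_k| ≤ 2 / k ^ α`, uniformly in `p`, and the upper bounds follow from
`n ≤ K n_1`.

For the lower bounds, `D_k(p) ≤ p (1 + log (k + 1) + log p)` and
`D_k(p) ≤ (k + 1) ^ (1 - α) p - α p ^ α`. As `k + 1 ≤ n`, at `p` a small multiple of `1 / n` all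
the `D_k(p)` are negative of the required order, and so is their average.
-/

namespace Jackknife

/-! ### Binomial expectations -/

/-- The expectation `𝔼[h(S)]` for `S` binomial with `q` trials and success probability `p`, defined
by conditioning on the outcome of one trial. -/
noncomputable def binomialExp (p : ℝ) : ℕ → (ℕ → ℝ) → ℝ
  | 0, h => h 0
  | q + 1, h => p * binomialExp p q (fun s => h (s + 1)) + (1 - p) * binomialExp p q h

theorem binomialExp_succ (p : ℝ) (q : ℕ) (h : ℕ → ℝ) :
    binomialExp p (q + 1) h =
      p * binomialExp p q (fun s => h (s + 1)) + (1 - p) * binomialExp p q h := rfl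

theorem binomialExp_const (p : ℝ) (q : ℕ) (c : ℝ) : binomialExp p q (fun _ => c) = c := by
  induction q with
  | zero => rfl
  | succ q ih => rw [binomialExp_succ, ih]; ring

theorem binomialExp_add (p : ℝ) (q : ℕ) (g h : ℕ → ℝ) :
    binomialExp p q (fun s => g s + h s) = binomialExp p q g + binomialExp p q h := by
  induction q generalizing g h with
  | zero => rfl
  | succ q ih => simp only [binomialExp_succ, ih]; ring

theorem binomialExp_const_mul (p : ℝ) (q : ℕ) (c : ℝ) (h : ℕ → ℝ) :
    binomialExp p q (fun s => c * h s) = c * binomialExp p q h := by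
  induction q generalizing h with
  | zero => rfl
  | succ q ih => simp only [binomialExp_succ, ih]; ring

theorem binomialExp_affine (p : ℝ) (q : ℕ) (c d : ℝ) (h : ℕ → ℝ) :
    binomialExp p q (fun s => c + d * h s) = c + d * binomialExp p q h := by
  rw [binomialExp_add, binomialExp_const, binomialExp_const_mul]

theorem binomialExp_sub (p : ℝ) (q : ℕ) (g h : ℕ → ℝ) :
    binomialExp p q (fun s => g s - h s) = binomialExp p q g - binomialExp p q h := by
  have := binomialExp_add p q (fun s => g s - h s) h
  simp only [sub_add_cancel] at this
  linarith

theorem binomialExp_mono {p : ℝ} (h0 : 0 ≤ p) (h1 : p ≤ 1) (q : ℕ) {g h : ℕ → ℝ}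
    (hgh : ∀ s, g s ≤ h s) : binomialExp p q g ≤ binomialExp p q h := by
  induction q generalizing g h with
  | zero => exact hgh 0
  | succ q ih =>
    have h2 := ih (g := fun s => g (s + 1)) (h := fun s => h (s + 1)) fun s => hgh _
    have h3 := ih hgh
    have h4 : 0 ≤ 1 - p := by linarith
    simp only [binomialExp_succ]
    gcongr

theorem binomialExp_zero_left (q : ℕ) (h : ℕ → ℝ) : binomialExp 0 q h = h 0 := by
  induction q with
  | zero => rfl
  | succ q ih => rw [binomialExp_succ, ih]; ring

theorem binomialExp_succ_eq_add_diff (p : ℝ) (q : ℕ) (h : ℕ → ℝ) :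
    binomialExp p (q + 1) h =
      binomialExp p q h + p * binomialExp p q (fun s => h (s + 1) - h s) := by
  rw [binomialExp_succ, binomialExp_sub]; ring

/-- The size-bias identity of the binomial distribution. -/
theorem binomialExp_natCast_mul (p : ℝ) (q : ℕ) (h : ℕ → ℝ) :
    binomialExp p (q + 1) (fun s => (s : ℝ) * h s) =
      (q + 1) * p * binomialExp p q (fun s => h (s + 1)) := by
  induction q generalizing h with
  | zero => simp [binomialExp]
  | succ q ih =>
    have e : binomialExp p (q + 1) (fun s => ((s + 1 : ℕ) : ℝ) * h (s + 1)) =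
        binomialExp p (q + 1) (fun s => (s : ℝ) * h (s + 1)) +
          binomialExp p (q + 1) (fun s => h (s + 1)) := by
      rw [← binomialExp_add]; congr 1; ext s; push_cast; ring
    rw [binomialExp_succ, e, ih (fun s => h (s + 1)), ih h, binomialExp_succ p q (fun s => h (s + 1))]
    push_cast
    ring

theorem binomialExp_natCast (p : ℝ) (q : ℕ) : binomialExp p q (fun s => (s : ℝ)) = q * p := by
  induction q with
  | zero => simp [binomialExp]
  | succ q ih =>
    have := binomialExp_natCast_mul p q (fun _ => 1)
    rw [binomialExp_const] at this
    simpa using this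

/-- By size bias, `(q + 1) p 𝔼[1 / (S + 1)]` is the probability that a binomial variable with
`q + 1` trials is nonzero. -/
theorem binomialExp_inv_succ_le {p : ℝ} (h0 : 0 ≤ p) (h1 : p ≤ 1) (q : ℕ) :
    (q + 1) * p * binomialExp p q (fun s => ((s : ℝ) + 1)⁻¹) ≤ 1 := by
  have h := binomialExp_natCast_mul p q (fun s => (s : ℝ)⁻¹)
  push_cast at h
  rw [← h]
  calc _ ≤ binomialExp p (q + 1) (fun _ => 1) := by
        refine binomialExp_mono h0 h1 _ fun s => ?_
        exact mul_inv_le_one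
    _ = 1 := binomialExp_const _ _ _

theorem binomialExp_inv_succ_nonneg {p : ℝ} (h0 : 0 ≤ p) (h1 : p ≤ 1) (q : ℕ) :
    0 ≤ binomialExp p q (fun s => ((s : ℝ) + 1)⁻¹) := by
  rw [← binomialExp_const p q 0]
  exact binomialExp_mono h0 h1 _ fun s => by positivity

/-! ### Expectations of U-statistics -/

theorem bernoulliExp_sum {β : Type*} (n : ℕ) (p : ℝ) (T : Finset β)
    (g : β → (Fin n → Bool) → ℝ) :
    bernoulliExp n p (fun x => ∑ b ∈ T, g b x) = ∑ b ∈ T, bernoulliExp n p (g b) := by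
  unfold bernoulliExp
  simp only [Finset.mul_sum]
  rw [Finset.sum_comm]

theorem bernoulliExp_const_mul (n : ℕ) (p c : ℝ) (g : (Fin n → Bool) → ℝ) :
    bernoulliExp n p (fun x => c * g x) = c * bernoulliExp n p g := by
  unfold bernoulliExp
  rw [Finset.mul_sum]
  exact Finset.sum_congr rfl fun x _ => by ring

theorem bernoulliExp_one (n : ℕ) (p : ℝ) : bernoulliExp n p (fun _ => 1) = 1 := by
  unfold bernoulliExp
  simp only [mul_one]
  have h := Finset.prod_univ_sum (fun _ : Fin n => (Finset.univ : Finset Bool))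
    (fun _ b => if b = true then p else 1 - p)
  simp only [Fintype.piFinset_univ] at h
  rw [← h]
  simp

/-- Conditioning on the `i`-th trial. -/
theorem bernoulliExp_eq_update {n : ℕ} (p : ℝ) (i : Fin n) (g : (Fin n → Bool) → ℝ) :
    bernoulliExp n p g =
      p * bernoulliExp n p (fun x => g (Function.update x i true)) +
        (1 - p) * bernoulliExp n p (fun x => g (Function.update x i false)) := by
  set w : Bool → ℝ := fun b => if b = true then p else 1 - p with hw
  have key : ∀ G : (Fin n → Bool) → ℝ, bernoulliExp n p G =
      ∑ y : {j // j ≠ i} → Bool, (∏ j, w (y j)) *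
        (p * G ((Equiv.funSplitAt i Bool).symm (true, y)) +
          (1 - p) * G ((Equiv.funSplitAt i Bool).symm (false, y))) := by
    intro G
    unfold bernoulliExp
    rw [← (Equiv.funSplitAt i Bool).symm.sum_comp, Fintype.sum_prod_type, Fintype.sum_bool,
      ← Finset.sum_add_distrib]
    refine Finset.sum_congr rfl fun y _ => ?_
    have hprod : ∀ b, (∏ j, w ((Equiv.funSplitAt i Bool).symm (b, y) j)) =
        w b * ∏ j, w (y j) := by
      intro b
      rw [Fintype.prod_eq_mul_prod_subtype_ne _ i]
      congr 1
      · simp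
      · refine Finset.prod_congr rfl fun j _ => ?_
        simp [j.2]
    have ht := hprod true
    have hf := hprod false
    simp only [hw] at ht hf ⊢
    rw [ht, hf]
    simp only [if_true, Bool.false_eq_true, if_false]
    ring
  have hupd : ∀ (b c : Bool) (y : {j // j ≠ i} → Bool),
      Function.update ((Equiv.funSplitAt i Bool).symm (c, y)) i b =
        (Equiv.funSplitAt i Bool).symm (b, y) := by
    intro b c y
    ext j
    by_cases hj : j = i
    · subst hj; simp
    · simp [hj]
  rw [key g, key (fun x => g (Function.update x i true)),
    key (fun x => g (Function.update x i false)), Finset.mul_sum, Finset.mul_sum,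
    ← Finset.sum_add_distrib]
  refine Finset.sum_congr rfl fun y _ => ?_
  simp only [hupd]
  ring

/-- The number of successes in a fixed subsample is binomial. -/
theorem bernoulliExp_card_filter {n : ℕ} (p : ℝ) (S : Finset (Fin n)) (h : ℕ → ℝ) :
    bernoulliExp n p (fun x => h (S.filter fun i => x i = true).card) =
      binomialExp p S.card h := by
  induction S using Finset.induction_on generalizing h with
  | empty =>
    have := bernoulliExp_const_mul n p (h 0) (fun _ => 1)
    rw [bernoulliExp_one] at this
    simpa [binomialExp] using this
  | insert i S hi ih =>
    rw [Finset.card_insert_of_notMem hi, binomialExp_succ, ← ih, ← ih,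
      bernoulliExp_eq_update p i]
    have hfilter : ∀ (x : Fin n → Bool) (b : Bool),
        S.filter (fun j => Function.update x i b j = true) = S.filter fun j => x j = true := by
      intro x b
      refine Finset.filter_congr fun j hj => ?_
      rw [Function.update_of_ne (ne_of_mem_of_not_mem hj hi)]
    congr 3
    · ext x
      rw [Finset.filter_insert, if_pos (by simp), hfilter, Finset.card_insert_of_notMem]
      simp [hi]
    · ext x
      rw [Finset.filter_insert, if_neg (by simp), hfilter]

theorem bernoulliExp_uStat (f : ℝ → ℝ) {n q : ℕ} (hq : q ≤ n) (p : ℝ) :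
    bernoulliExp n p (uStat f n q) = binomialExp p q (fun s => f (s / q)) := by
  have e : uStat f n q = fun x => (n.choose q : ℝ)⁻¹ *
      ∑ S ∈ Finset.powersetCard q (Finset.univ : Finset (Fin n)), f (empFreq x S) := by
    ext x; unfold uStat; rw [div_eq_inv_mul]
  rw [e, bernoulliExp_const_mul, bernoulliExp_sum]
  have hS : ∀ S ∈ Finset.powersetCard q (Finset.univ : Finset (Fin n)),
      bernoulliExp n p (fun x => f (empFreq x S)) = binomialExp p q (fun s => f (s / q)) := by
    intro S hS
    rw [Finset.mem_powersetCard] at hS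
    have := bernoulliExp_card_filter p S (fun s => f (s / q))
    rw [hS.2] at this
    rw [← this]
    unfold empFreq
    rw [hS.2]
  rw [Finset.sum_congr rfl hS, Finset.sum_const, Finset.card_powersetCard, Finset.card_univ,
    Fintype.card_fin, nsmul_eq_mul]
  have : (n.choose q : ℝ) ≠ 0 := by exact_mod_cast (Nat.choose_pos hq).ne'
  field_simp

/-! ### The bias as an average of consecutive differences -/

/-- The bias at `p` of the `2`-jackknife with sample sizes `k` and `k + 1`. -/
noncomputable def stepBias (f : ℝ → ℝ) (p : ℝ) (k : ℕ) : ℝ :=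
  ((k + 1 : ℕ) : ℝ) * binomialExp p (k + 1) (fun s => f (s / (k + 1 : ℕ))) -
    (k : ℝ) * binomialExp p k (fun s => f (s / k)) - f p

theorem bias_eq_average (f : ℝ → ℝ) {K : ℝ} {n : ℕ} {m : Fin 2 → ℕ} (hm : IsSizes K n m)
    (p : ℝ) :
    bernoulliExp n p (estimator f n m) - f p =
      (∑ k ∈ Finset.Ico (m 0) (m 1), stepBias f p k) / ((m 1 : ℝ) - m 0) := by
  have hlt : m 0 < m 1 := hm.strictMono (by simp)
  have hne : (m 1 : ℝ) - m 0 ≠ 0 := by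
    have : (m 0 : ℝ) < m 1 := by exact_mod_cast hlt
    linarith
  have hne' : (m 0 : ℝ) - m 1 ≠ 0 := by
    rw [← neg_sub]; exact neg_ne_zero.mpr hne
  have hE : bernoulliExp n p (estimator f n m) =
      coeff m 0 * binomialExp p (m 0) (fun s => f (s / m 0)) +
        coeff m 1 * binomialExp p (m 1) (fun s => f (s / m 1)) := by
    unfold estimator
    rw [bernoulliExp_sum, Fin.sum_univ_two, bernoulliExp_const_mul, bernoulliExp_const_mul,
      bernoulliExp_uStat f (hm.le_n 0), bernoulliExp_uStat f (hm.le_n 1)]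
  have h0 : coeff m 0 = (m 0 : ℝ) / ((m 0 : ℝ) - m 1) := by
    unfold coeff
    rw [show (Finset.univ.erase (0 : Fin 2)) = {1} by decide, Finset.prod_singleton]
  have h1 : coeff m 1 = (m 1 : ℝ) / ((m 1 : ℝ) - m 0) := by
    unfold coeff
    rw [show (Finset.univ.erase (1 : Fin 2)) = {0} by decide, Finset.prod_singleton]
  have hsum : ∑ k ∈ Finset.Ico (m 0) (m 1), stepBias f p k =
      (m 1 : ℝ) * binomialExp p (m 1) (fun s => f (s / m 1)) -
        (m 0 : ℝ) * binomialExp p (m 0) (fun s => f (s / m 0)) - ((m 1 : ℝ) - m 0) * f p := by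
    unfold stepBias
    rw [Finset.sum_sub_distrib,
      Finset.sum_Ico_sub (fun k : ℕ => (k : ℝ) * binomialExp p k (fun s => f (s / k))) hlt.le,
      Finset.sum_const, Nat.card_Ico, nsmul_eq_mul, Nat.cast_sub hlt.le]
  rw [hE, h0, h1, hsum]
  field_simp
  rw [← neg_sub (m 1 : ℝ) (m 0 : ℝ)]
  field_simp
  ring

theorem bias_le (f : ℝ → ℝ) {K : ℝ} {n : ℕ} {m : Fin 2 → ℕ} (hm : IsSizes K n m) {p u : ℝ}
    (h : ∀ k, m 0 ≤ k → k < m 1 → stepBias f p k ≤ u) :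
    bernoulliExp n p (estimator f n m) - f p ≤ u := by
  have hlt : m 0 < m 1 := hm.strictMono (by simp)
  have hpos : 0 < (m 1 : ℝ) - m 0 := by
    have : (m 0 : ℝ) < m 1 := by exact_mod_cast hlt
    linarith
  rw [bias_eq_average f hm, div_le_iff₀ hpos]
  have := Finset.sum_le_card_nsmul (Finset.Ico (m 0) (m 1)) (stepBias f p) u fun k hk =>
    h k (Finset.mem_Ico.mp hk).1 (Finset.mem_Ico.mp hk).2
  rw [Nat.card_Ico, nsmul_eq_mul, Nat.cast_sub hlt.le] at this
  linarith

theorem le_bias (f : ℝ → ℝ) {K : ℝ} {n : ℕ} {m : Fin 2 → ℕ} (hm : IsSizes K n m) {p u : ℝ}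
    (h : ∀ k, m 0 ≤ k → k < m 1 → u ≤ stepBias f p k) :
    u ≤ bernoulliExp n p (estimator f n m) - f p := by
  have hlt : m 0 < m 1 := hm.strictMono (by simp)
  have hpos : 0 < (m 1 : ℝ) - m 0 := by
    have : (m 0 : ℝ) < m 1 := by exact_mod_cast hlt
    linarith
  rw [bias_eq_average f hm, le_div_iff₀ hpos]
  have := Finset.card_nsmul_le_sum (Finset.Ico (m 0) (m 1)) (stepBias f p) u fun k hk =>
    h k (Finset.mem_Ico.mp hk).1 (Finset.mem_Ico.mp hk).2
  rw [Nat.card_Ico, nsmul_eq_mul, Nat.cast_sub hlt.le] at this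
  linarith

theorem stepBias_zero_prob {f : ℝ → ℝ} (hf : f 0 = 0) (k : ℕ) : stepBias f 0 k = 0 := by
  simp [stepBias, binomialExp_zero_left, hf]

theorem biasNorm_le (f : ℝ → ℝ) {K : ℝ} {n : ℕ} {m : Fin 2 → ℕ} (hm : IsSizes K n m) {u : ℝ}
    (h : ∀ p, 0 ≤ p → p ≤ 1 → ∀ k, m 0 ≤ k → k < m 1 → |stepBias f p k| ≤ u) :
    biasNorm f n m ≤ ENNReal.ofReal u := by
  refine iSup₂_le fun p hp => ENNReal.ofReal_le_ofReal (abs_le.mpr ⟨?_, ?_⟩)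
  · exact le_bias f hm fun k hk hk' => (abs_le.mp (h p hp.1 hp.2 k hk hk')).1
  · exact bias_le f hm fun k hk hk' => (abs_le.mp (h p hp.1 hp.2 k hk hk')).2

theorem le_biasNorm (f : ℝ → ℝ) {K : ℝ} {n : ℕ} {m : Fin 2 → ℕ} (hm : IsSizes K n m)
    {p u : ℝ} (h0 : 0 ≤ p) (h1 : p ≤ 1)
    (h : ∀ k, m 0 ≤ k → k < m 1 → stepBias f p k ≤ -u) :
    ENNReal.ofReal u ≤ biasNorm f n m := by
  refine le_iSup₂_of_le p ⟨h0, h1⟩ (ENNReal.ofReal_le_ofReal ?_)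
  have := bias_le f hm h
  exact (le_neg_of_le_neg this).trans (neg_le_abs _)

/-! ### Entropy -/

theorem stepBias_entropy {k : ℕ} (hk : 1 ≤ k) (p : ℝ) :
    stepBias (fun x => -x * Real.log x) p k =
      p * ((((k : ℝ) + 1) * Real.log (k + 1) - k * Real.log k) -
        binomialExp p k (fun s => ((s : ℝ) + 1) * Real.log (s + 1) - s * Real.log s) +
        Real.log p) := by
  have hF : ∀ j : ℕ, 1 ≤ j → (j : ℝ) * binomialExp p j
      (fun s => -((s : ℝ) / j) * Real.log ((s : ℝ) / j)) =
      -binomialExp p j (fun s => (s : ℝ) * Real.log s) + j * p * Real.log j := by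
    intro j hj
    have hj' : (j : ℝ) ≠ 0 := by positivity
    rw [← binomialExp_const_mul, ← binomialExp_natCast]
    have : ∀ s : ℕ, (j : ℝ) * (-((s : ℝ) / j) * Real.log ((s : ℝ) / j)) =
        -1 * ((s : ℝ) * Real.log s) + Real.log j * s := by
      intro s
      rcases Nat.eq_zero_or_pos s with rfl | hs
      · simp
      · rw [Real.log_div (by positivity) hj']
        field_simp
        ring
    simp only [this]
    rw [binomialExp_add, binomialExp_const_mul, binomialExp_const_mul]
    ring
  have hd := binomialExp_succ_eq_add_diff p k (fun s => (s : ℝ) * Real.log s)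
  unfold stepBias
  simp only
  rw [hF k hk, hF (k + 1) (by omega), hd]
  push_cast
  ring

theorem log_le_log_add_div {x y : ℝ} (hx : 0 < x) (hy : 0 < y) :
    Real.log y ≤ Real.log x + (y - x) / x := by
  have h := Real.log_le_sub_one_of_pos (div_pos hy hx)
  rw [Real.log_div hy.ne' hx.ne'] at h
  have : (y - x) / x = y / x - 1 := by field_simp
  linarith

theorem succ_mul_log_sub_le (s : ℕ) :
    ((s : ℝ) + 1) * Real.log (s + 1) - s * Real.log s ≤ Real.log (s + 1) + 1 := by
  rcases Nat.eq_zero_or_pos s with rfl | hs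
  · simp
  · have hs' : (0 : ℝ) < s := by exact_mod_cast hs
    have h := log_le_log_add_div hs' (show (0 : ℝ) < s + 1 by positivity)
    have e : (s : ℝ) * ((s + 1 - s) / s) = 1 := by field_simp; ring
    nlinarith

theorem le_succ_mul_log_sub (s : ℕ) :
    Real.log (s + 1) + 1 - ((s : ℝ) + 1)⁻¹ ≤
      ((s : ℝ) + 1) * Real.log (s + 1) - s * Real.log s := by
  rcases Nat.eq_zero_or_pos s with rfl | hs
  · simp
  · have hs' : (0 : ℝ) < s := by exact_mod_cast hs
    have h := log_le_log_add_div (show (0 : ℝ) < s + 1 by positivity) hs'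
    have e : (s : ℝ) * ((s - (s + 1)) / (s + 1)) = ((s : ℝ) + 1)⁻¹ - 1 := by field_simp; ring
    nlinarith

theorem binomialExp_succ_mul_log_sub_le {p : ℝ} (h0 : 0 ≤ p) (h1 : p ≤ 1) (k : ℕ) :
    binomialExp p k (fun s => ((s : ℝ) + 1) * Real.log (s + 1) - s * Real.log s) ≤
      Real.log (k * p + 1) + 1 := by
  have hx : 0 < (k : ℝ) * p + 1 := by positivity
  -- the tangent line of `log` at `𝔼[S] + 1` gives Jensen's inequality
  calc _ ≤ binomialExp p k (fun s => (Real.log (k * p + 1) + 1 - k * p / (k * p + 1)) +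
        (1 / (k * p + 1)) * (s : ℝ)) := by
        refine binomialExp_mono h0 h1 _ fun s => (succ_mul_log_sub_le s).trans ?_
        have h := log_le_log_add_div hx (show (0 : ℝ) < s + 1 by positivity)
        have e : ((s : ℝ) + 1 - (k * p + 1)) / (k * p + 1) =
          1 / (k * p + 1) * s - k * p / (k * p + 1) := by field_simp; ring
        linarith
    _ = _ := by
        rw [binomialExp_affine, binomialExp_natCast]
        ring

theorem le_binomialExp_succ_mul_log_sub {p : ℝ} (h0 : 0 < p) (h1 : p ≤ 1) {k : ℕ} (hk : 1 ≤ k) :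
    Real.log (k * p) + 2 - (k * p + 1) * binomialExp p k (fun s => ((s : ℝ) + 1)⁻¹) ≤
      binomialExp p k (fun s => ((s : ℝ) + 1) * Real.log (s + 1) - s * Real.log s) := by
  have hk' : (0 : ℝ) < k := by exact_mod_cast hk
  have hx : 0 < (k : ℝ) * p := by positivity
  calc _ = binomialExp p k (fun s => (Real.log (k * p) + 2) +
        (-(k * p + 1)) * ((s : ℝ) + 1)⁻¹) := by
        rw [binomialExp_affine]; ring
    _ ≤ _ := by
        refine binomialExp_mono h0.le h1 _ fun s => le_trans ?_ (le_succ_mul_log_sub s)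
        have h := log_le_log_add_div (show (0 : ℝ) < s + 1 by positivity) hx
        have e : ((k : ℝ) * p - (s + 1)) / (s + 1) = k * p * ((s : ℝ) + 1)⁻¹ - 1 := by
          field_simp
        linarith

theorem abs_stepBias_entropy_le {k : ℕ} (hk : 1 ≤ k) {p : ℝ} (h0 : 0 ≤ p) (h1 : p ≤ 1) :
    |stepBias (fun x => -x * Real.log x) p k| ≤ 2 / k := by
  have hk' : (0 : ℝ) < k := by exact_mod_cast hk
  rcases h0.eq_or_lt with rfl | hp
  · rw [stepBias_zero_prob (by simp), abs_zero]; positivity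
  have hx : 0 < (k : ℝ) * p := by positivity
  rw [stepBias_entropy hk p]
  have hU := binomialExp_succ_mul_log_sub_le h0 h1 k
  have hL := le_binomialExp_succ_mul_log_sub hp h1 hk
  have hR := binomialExp_inv_succ_le h0 h1 k
  have hR0 := binomialExp_inv_succ_nonneg h0 h1 k
  set E := binomialExp p k (fun s => ((s : ℝ) + 1) * Real.log (s + 1) - s * Real.log s)
  set R := binomialExp p k (fun s => ((s : ℝ) + 1)⁻¹)
  have hlog : Real.log (k * p) = Real.log k + Real.log p := Real.log_mul hk'.ne' hp.ne'
  have hs1 := succ_mul_log_sub_le k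
  have hs2 := le_succ_mul_log_sub k
  set P := ((k : ℝ) + 1) * Real.log (k + 1) - k * Real.log k
  have hk1 := log_le_log_add_div hk' (show (0 : ℝ) < k + 1 by positivity)
  have hk2 : Real.log k ≤ Real.log (k + 1) := Real.log_le_log hk' (by linarith)
  have hx1 := log_le_log_add_div hx (show (0 : ℝ) < k * p + 1 by positivity)
  have e1 : ((k : ℝ) + 1 - k) / k = 1 / k := by ring
  have e2 : ((k : ℝ) * p + 1 - k * p) / (k * p) = 1 / (k * p) := by ring
  have hinv : ((k : ℝ) + 1)⁻¹ ≤ 1 / k := by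
    rw [← one_div]; exact one_div_le_one_div_of_le hk' (by linarith)
  have hpk : p * (1 / k) ≤ 1 / k := by
    have : 0 ≤ 1 / (k : ℝ) := by positivity
    nlinarith
  have hpx : p * (1 / (k * p)) = 1 / k := by field_simp
  have e3 : (2 : ℝ) / k = 1 / k + 1 / k := by ring
  have hpR : p * R ≤ 1 / k := by
    rw [le_div_iff₀ hk']; nlinarith [mul_nonneg hp.le hR0]
  rw [abs_le]
  constructor
  · have : -(1 / k) - 1 / (k * p) ≤ P - E + Real.log p := by linarith
    have := mul_le_mul_of_nonneg_left this hp.le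
    linarith
  · have : P - E + Real.log p ≤ 1 / k + R := by nlinarith [mul_nonneg hp.le hR0]
    have := mul_le_mul_of_nonneg_left this hp.le
    linarith

/-- For `p` well below `1 / k` the logarithm of `p` dominates and makes the bias negative. -/
theorem stepBias_entropy_le {k : ℕ} (hk : 1 ≤ k) {p : ℝ} (hp : 0 < p) (h1 : p ≤ 1) :
    stepBias (fun x => -x * Real.log x) p k ≤ p * (1 + Real.log (k + 1) + Real.log p) := by
  rw [stepBias_entropy hk p]
  have hE : 0 ≤ binomialExp p k
      (fun s => ((s : ℝ) + 1) * Real.log (s + 1) - s * Real.log s) := by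
    rw [← binomialExp_const p k 0]
    refine binomialExp_mono hp.le h1 _ fun s => le_trans ?_ (le_succ_mul_log_sub s)
    have h2 : 0 ≤ Real.log ((s : ℝ) + 1) := Real.log_nonneg (by linarith [s.cast_nonneg (α := ℝ)])
    have h3 : ((s : ℝ) + 1)⁻¹ ≤ 1 := inv_le_one_of_one_le₀ (by linarith [s.cast_nonneg (α := ℝ)])
    linarith
  have := succ_mul_log_sub_le k
  exact mul_le_mul_of_nonneg_left (by linarith) hp.le

/-! ### Powers -/

theorem stepBias_rpow {k : ℕ} (hk : 1 ≤ k) (p α : ℝ) :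
    stepBias (fun x => x ^ α) p k =
      (((k : ℝ) + 1) ^ (1 - α) - (k : ℝ) ^ (1 - α)) * binomialExp p k (fun s => (s : ℝ) ^ α) +
        ((k : ℝ) + 1) ^ (1 - α) *
          (p * binomialExp p k (fun s => ((s : ℝ) + 1) ^ α - (s : ℝ) ^ α)) - p ^ α := by
  have hF : ∀ j : ℕ, 1 ≤ j → (j : ℝ) * binomialExp p j (fun s => ((s : ℝ) / j) ^ α) =
      (j : ℝ) ^ (1 - α) * binomialExp p j (fun s => (s : ℝ) ^ α) := by
    intro j hj
    have hj' : (0 : ℝ) < j := by exact_mod_cast hj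
    rw [← binomialExp_const_mul, ← binomialExp_const_mul]
    congr 1
    ext s
    rw [Real.div_rpow (by positivity) (by positivity), Real.rpow_sub hj', Real.rpow_one]
    field_simp
  have hd := binomialExp_succ_eq_add_diff p k (fun s => (s : ℝ) ^ α)
  unfold stepBias
  simp only
  rw [hF k hk, hF (k + 1) (by omega), hd]
  push_cast
  ring



/-- The graph of `y ↦ y ^ α` lies below its tangent line at `x`. -/
theorem rpow_le_tangent {α : ℝ} (ha0 : 0 ≤ α) (ha1 : α ≤ 1) {x y : ℝ} (hx : 0 < x) (hy : 0 ≤ y) :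
    y ^ α ≤ x ^ α * (1 + α * (y / x - 1)) := by
  have h := rpow_one_add_le_one_add_mul_self (s := y / x - 1)
    (by have : 0 ≤ y / x := by positivity
        linarith) ha0 ha1
  rw [add_sub_cancel, Real.div_rpow hy hx.le, div_le_iff₀ (by positivity)] at h
  linarith

/-- The tangent-line inequality for the convex function `z ↦ z ^ (-α)` at `z = x⁻¹`, written with
`y = z⁻¹`: a lower bound for `y ^ α` that is affine in `y⁻¹`. -/
theorem le_rpow_tangent_inv {α : ℝ} (ha : 0 ≤ α) {x y : ℝ} (hx : 0 < x) (hy : 0 < y) :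
    x ^ α * (1 + α * (1 - x / y)) ≤ y ^ α := by
  have h1 := Real.one_sub_inv_le_log_of_pos (div_pos hy hx)
  have h2 := Real.add_one_le_exp (Real.log (y / x) * α)
  rw [← Real.rpow_def_of_pos (div_pos hy hx), Real.div_rpow hy.le hx.le,
    le_div_iff₀ (by positivity)] at h2
  rw [inv_div] at h1
  have h3 : 1 + α * (1 - x / y) ≤ Real.log (y / x) * α + 1 := by
    linarith [mul_le_mul_of_nonneg_left h1 ha]
  linarith [mul_le_mul_of_nonneg_left h3 (Real.rpow_nonneg hx.le α)]

theorem mul_inv_rpow_one_sub (α : ℝ) {x : ℝ} (hx : 0 < x) : x * x⁻¹ ^ (1 - α) = x ^ α := by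
  rw [Real.inv_rpow hx.le, Real.rpow_sub hx, Real.rpow_one, inv_div]
  field_simp

theorem rpow_succ_sub_le_one {α : ℝ} (ha0 : 0 ≤ α) (ha1 : α ≤ 1) {x : ℝ} (hx : 0 ≤ x) :
    (x + 1) ^ α - x ^ α ≤ 1 := by
  have := Real.rpow_add_le_add_rpow hx zero_le_one ha0 ha1
  rw [Real.one_rpow] at this
  linarith

theorem le_rpow_succ_sub {α : ℝ} (ha0 : 0 ≤ α) (ha1 : α ≤ 1) (s : ℕ) :
    α * ((s : ℝ) + 1)⁻¹ ^ (1 - α) ≤ ((s : ℝ) + 1) ^ α - (s : ℝ) ^ α := by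
  have ht : (0 : ℝ) < s + 1 := by positivity
  have h := rpow_le_tangent ha0 ha1 ht s.cast_nonneg
  have e := mul_inv_rpow_one_sub α ht
  have e2 : (s : ℝ) / (s + 1) - 1 = -((s : ℝ) + 1)⁻¹ := by field_simp; ring
  rw [e2] at h
  have e3 : ((s : ℝ) + 1) ^ α * ((s : ℝ) + 1)⁻¹ = ((s : ℝ) + 1)⁻¹ ^ (1 - α) := by
    rw [← e]; field_simp
  rw [← e3]
  linarith

/-- The second term on the right accounts for the increment `1` at `s = 0`, where the derivative of
`x ↦ x ^ α` is infinite. -/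
theorem rpow_succ_sub_le {α : ℝ} (ha0 : 0 < α) (ha1 : α < 1) (s : ℕ) :
    ((s : ℝ) + 1) ^ α - (s : ℝ) ^ α ≤
      α * ((s : ℝ) + 1)⁻¹ ^ (1 - α) + (1 - α) * ((s : ℝ) + 1)⁻¹ := by
  rcases Nat.eq_zero_or_pos s with rfl | hs
  · simp [Real.zero_rpow ha0.ne']
  have hs' : (0 : ℝ) < s := by exact_mod_cast hs
  have ht : (0 : ℝ) < s + 1 := by positivity
  have h := le_rpow_tangent_inv (by linarith : 0 ≤ 1 - α) (inv_pos.mpr ht) (inv_pos.mpr hs')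
  have hw1 : ((s : ℝ) + 1)⁻¹ ^ (1 - α) ≤ 1 :=
    Real.rpow_le_one (by positivity) (inv_le_one_of_one_le₀ (by linarith)) (by linarith)
  rw [← mul_inv_rpow_one_sub α ht, ← mul_inv_rpow_one_sub α hs']
  have e : 1 - ((s : ℝ) + 1)⁻¹ / (s : ℝ)⁻¹ = ((s : ℝ) + 1)⁻¹ := by field_simp; ring
  rw [e] at h
  set w := ((s : ℝ) + 1)⁻¹ ^ (1 - α)
  have e2 : ((s : ℝ) + 1) * w - s * (w * (1 + (1 - α) * ((s : ℝ) + 1)⁻¹)) =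
      α * w + w * ((1 - α) * ((s : ℝ) + 1)⁻¹) := by field_simp; ring
  have h2 := mul_le_mul_of_nonneg_left h hs'.le
  have h3 : 0 ≤ (1 - α) * ((s : ℝ) + 1)⁻¹ := mul_nonneg (by linarith) (by positivity)
  have h4 := mul_le_mul_of_nonneg_right hw1 h3
  linarith

/-- Jensen's inequality, in the form of a tangent line at `𝔼[S]`. -/
theorem binomialExp_rpow_le {α : ℝ} (ha0 : 0 ≤ α) (ha1 : α ≤ 1) {p : ℝ} (h0 : 0 ≤ p)
    (h1 : p ≤ 1) {k : ℕ} (hx : 0 < (k : ℝ) * p) :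
    binomialExp p k (fun s => (s : ℝ) ^ α) ≤ ((k : ℝ) * p) ^ α := by
  calc _ ≤ binomialExp p k (fun s => ((k : ℝ) * p) ^ α * (1 - α) +
        (((k : ℝ) * p) ^ α * (α / (k * p))) * (s : ℝ)) := by
        refine binomialExp_mono h0 h1 _ fun s => ?_
        refine (rpow_le_tangent ha0 ha1 hx s.cast_nonneg).trans_eq ?_
        ring
    _ = _ := by
        rw [binomialExp_affine, binomialExp_natCast]
        have : α / (k * p) * (k * p) = α := div_mul_cancel₀ _ hx.ne'
        linear_combination ((k : ℝ) * p) ^ α * this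

/-- An almost converse to Jensen's inequality: `𝔼[S ^ α]` and `𝔼[(S + 1) ^ α]` differ by at most
`1`, and the latter has a lower bound affine in `𝔼[1 / (S + 1)]`. -/
theorem le_binomialExp_rpow {α : ℝ} (ha0 : 0 ≤ α) (ha1 : α ≤ 1) {p : ℝ} (h0 : 0 ≤ p)
    (h1 : p ≤ 1) {k : ℕ} (hx : 0 < (k : ℝ) * p) :
    ((k : ℝ) * p) ^ α - 1 ≤ binomialExp p k (fun s => (s : ℝ) ^ α) := by
  have hR := binomialExp_inv_succ_le h0 h1 k
  have hR0 := binomialExp_inv_succ_nonneg h0 h1 k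
  set R := binomialExp p k (fun s => ((s : ℝ) + 1)⁻¹) with hRdef
  set X := ((k : ℝ) * p) ^ α
  have hX : 0 ≤ X := by positivity
  calc X - 1 ≤ (X * (1 + α) - 1) + (-(X * α * (k * p))) * R := by
        have : k * p * R ≤ 1 := by nlinarith [mul_nonneg h0 hR0]
        nlinarith [mul_le_mul_of_nonneg_left this (mul_nonneg hX ha0)]
    _ = binomialExp p k (fun s => (X * (1 + α) - 1) +
        (-(X * α * (k * p))) * ((s : ℝ) + 1)⁻¹) := by rw [binomialExp_affine]
    _ ≤ _ := by
        refine binomialExp_mono h0 h1 _ fun s => ?_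
        have h := le_rpow_tangent_inv (by linarith : 0 ≤ α) hx (show (0 : ℝ) < s + 1 by positivity)
        have h' := rpow_succ_sub_le_one ha0 ha1 (s.cast_nonneg (α := ℝ))
        have e : X * (1 + α * (1 - (k : ℝ) * p / (s + 1))) =
          X * (1 + α) + (-(X * α * (k * p))) * ((s : ℝ) + 1)⁻¹ := by ring
        have h'' : X * (1 + α * (1 - (k : ℝ) * p / (s + 1))) ≤ ((s : ℝ) + 1) ^ α := h
        linarith

theorem mul_binomialExp_rpow_succ_sub_le {α : ℝ} (ha0 : 0 < α) (ha1 : α < 1) {p : ℝ}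
    (h0 : 0 ≤ p) (h1 : p ≤ 1) {k : ℕ} (hx : 0 < (k : ℝ) * p) :
    k * p * binomialExp p k (fun s => ((s : ℝ) + 1) ^ α - (s : ℝ) ^ α) ≤
      α * ((k : ℝ) * p) ^ α + (1 - α) := by
  have hR := binomialExp_inv_succ_le h0 h1 k
  have hR0 := binomialExp_inv_succ_nonneg h0 h1 k
  have hxinv : (0 : ℝ) < ((k : ℝ) * p)⁻¹ := by positivity
  set R := binomialExp p k (fun s => ((s : ℝ) + 1)⁻¹) with hRdef
  have hxR : k * p * R ≤ 1 := by nlinarith [mul_nonneg h0 hR0]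
  have e := mul_inv_rpow_one_sub α hx
  set V := ((k : ℝ) * p)⁻¹ ^ (1 - α)
  have hV : 0 ≤ V := by positivity
  have key : binomialExp p k (fun s => ((s : ℝ) + 1) ^ α - (s : ℝ) ^ α) ≤
      α * V * α + (α * V * ((1 - α) * (k * p)) + (1 - α)) * R := by
    rw [← binomialExp_affine]
    refine binomialExp_mono h0 h1 _ fun s => (rpow_succ_sub_le ha0 ha1 s).trans ?_
    have ht : (0 : ℝ) < s + 1 := by positivity
    have h := rpow_le_tangent (sub_nonneg.mpr ha1.le) (by linarith : 1 - α ≤ 1) hxinv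
      (inv_pos.mpr ht).le
    have h' : ((s : ℝ) + 1)⁻¹ ^ (1 - α) ≤
        V * (1 + (1 - α) * (((s : ℝ) + 1)⁻¹ / ((k : ℝ) * p)⁻¹ - 1)) := h
    rw [div_inv_eq_mul] at h'
    nlinarith
  have h2 := mul_le_mul_of_nonneg_left key hx.le
  have h3 : 0 ≤ α * (k * p * V) * (1 - α) + (1 - α) := by
    have : 0 < 1 - α := by linarith
    positivity
  have h4 := mul_le_mul_of_nonneg_left hxR h3
  rw [← e]
  nlinarith

theorem le_mul_binomialExp_rpow_succ_sub {α : ℝ} (ha0 : 0 < α) (ha1 : α < 1) {p : ℝ}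
    (h0 : 0 ≤ p) (h1 : p ≤ 1) {k : ℕ} (hx : 0 < (k : ℝ) * p) :
    α * ((k : ℝ) * p) ^ α - α ≤
      k * p * binomialExp p k (fun s => ((s : ℝ) + 1) ^ α - (s : ℝ) ^ α) := by
  have hy : 0 < (k : ℝ) * p + 1 := by positivity
  have hyinv : 0 < ((k : ℝ) * p + 1)⁻¹ := by positivity
  have e := mul_inv_rpow_one_sub α hy
  have hV1 : ((k : ℝ) * p + 1)⁻¹ ^ (1 - α) ≤ 1 :=
    Real.rpow_le_one hyinv.le (inv_le_one_of_one_le₀ (by linarith)) (by linarith)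
  have hmono : ((k : ℝ) * p) ^ α ≤ ((k : ℝ) * p + 1) ^ α :=
    Real.rpow_le_rpow hx.le (by linarith) ha0.le
  set V := ((k : ℝ) * p + 1)⁻¹ ^ (1 - α)
  have key : α * V ≤ binomialExp p k (fun s => ((s : ℝ) + 1) ^ α - (s : ℝ) ^ α) := by
    calc α * V = α * V * (1 + (1 - α) * (k * p / (k * p + 1))) +
          (-(α * V * ((1 - α) / (k * p + 1)))) * (k * p) := by ring
      _ = binomialExp p k (fun s => α * V * (1 + (1 - α) * (k * p / (k * p + 1))) +
          (-(α * V * ((1 - α) / (k * p + 1)))) * (s : ℝ)) := by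
          rw [binomialExp_affine, binomialExp_natCast]
      _ ≤ _ := by
          refine binomialExp_mono h0 h1 _ fun s => le_trans ?_ (le_rpow_succ_sub ha0.le ha1.le s)
          have ht : (0 : ℝ) < s + 1 := by positivity
          have h := le_rpow_tangent_inv (by linarith : 0 ≤ 1 - α) hyinv (inv_pos.mpr ht)
          have h' : V * (1 + (1 - α) * (1 - ((k : ℝ) * p + 1)⁻¹ / ((s : ℝ) + 1)⁻¹)) ≤
            ((s : ℝ) + 1)⁻¹ ^ (1 - α) := h
          refine le_trans (le_of_eq ?_) (mul_le_mul_of_nonneg_left h' ha0.le)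
          field_simp
          ring
  have h2 := mul_le_mul_of_nonneg_left key hx.le
  nlinarith

theorem binomialExp_rpow_succ_sub_nonneg {α : ℝ} (ha0 : 0 ≤ α) {p : ℝ} (h0 : 0 ≤ p)
    (h1 : p ≤ 1) (k : ℕ) :
    0 ≤ binomialExp p k (fun s => ((s : ℝ) + 1) ^ α - (s : ℝ) ^ α) := by
  rw [← binomialExp_const p k 0]
  exact binomialExp_mono h0 h1 _ fun s =>
    sub_nonneg.mpr (Real.rpow_le_rpow s.cast_nonneg (by linarith) ha0)

theorem binomialExp_rpow_succ_sub_le_one {α : ℝ} (ha0 : 0 ≤ α) (ha1 : α ≤ 1) {p : ℝ}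
    (h0 : 0 ≤ p) (h1 : p ≤ 1) (k : ℕ) :
    binomialExp p k (fun s => ((s : ℝ) + 1) ^ α - (s : ℝ) ^ α) ≤ 1 := by
  refine (binomialExp_mono h0 h1 _ fun s =>
    rpow_succ_sub_le_one ha0 ha1 s.cast_nonneg).trans_eq (binomialExp_const p k 1)

theorem rpow_mul_succ_rpow_one_sub_le {α : ℝ} (ha0 : 0 ≤ α) (ha1 : α ≤ 1) {k : ℝ} (hk : 0 < k) :
    k ^ α * (k + 1) ^ (1 - α) ≤ k + (1 - α) := by
  have h := rpow_le_tangent (sub_nonneg.mpr ha1) (by linarith : 1 - α ≤ 1) hk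
    (by linarith : 0 ≤ k + 1)
  have e : k ^ α * k ^ (1 - α) = k := by rw [← Real.rpow_add hk]; simp
  have h2 := mul_le_mul_of_nonneg_left h (Real.rpow_nonneg hk.le α)
  rw [← mul_assoc, e] at h2
  refine h2.trans_eq ?_
  field_simp
  ring

theorem le_rpow_mul_succ_rpow_one_sub {α : ℝ} (ha1 : α ≤ 1) {k : ℝ} (hk : 0 < k) :
    k + (1 - α) * (k / (k + 1)) ≤ k ^ α * (k + 1) ^ (1 - α) := by
  have h := le_rpow_tangent_inv (by linarith : 0 ≤ 1 - α) hk (by linarith : 0 < k + 1)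
  have e : k ^ α * k ^ (1 - α) = k := by rw [← Real.rpow_add hk]; simp
  have h2 := mul_le_mul_of_nonneg_left h (Real.rpow_nonneg hk.le α)
  rw [← mul_assoc, e] at h2
  refine le_trans (le_of_eq ?_) h2
  field_simp
  ring

theorem abs_stepBias_rpow_le {α : ℝ} (ha0 : 0 < α) (ha1 : α < 1) {k : ℕ} (hk : 1 ≤ k) {p : ℝ}
    (h0 : 0 ≤ p) (h1 : p ≤ 1) :
    |stepBias (fun x => x ^ α) p k| ≤ 2 / (k : ℝ) ^ α := by
  have hk1 : (1 : ℝ) ≤ k := by exact_mod_cast hk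
  have hk' : (0 : ℝ) < k := by linarith
  rcases h0.eq_or_lt with rfl | hp
  · rw [stepBias_zero_prob (by simp [Real.zero_rpow ha0.ne']), abs_zero]; positivity
  have hx : 0 < (k : ℝ) * p := by positivity
  have hc : 0 < (k : ℝ) ^ α := by positivity
  have hmul := abs_mul (stepBias (fun x => x ^ α) p k) ((k : ℝ) ^ α)
  rw [abs_of_pos hc] at hmul
  rw [le_div_iff₀ hc, ← hmul, stepBias_rpow hk]
  have hA1 := binomialExp_rpow_le ha0.le ha1.le h0 h1 hx
  have hA2 := le_binomialExp_rpow ha0.le ha1.le h0 h1 hx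
  have hD1 := mul_binomialExp_rpow_succ_sub_le ha0 ha1 h0 h1 hx
  have hD2 := le_mul_binomialExp_rpow_succ_sub ha0 ha1 h0 h1 hx
  have hD3 := binomialExp_rpow_succ_sub_nonneg ha0.le h0 h1 k
  have hD4 := binomialExp_rpow_succ_sub_le_one ha0.le ha1.le h0 h1 k
  have hr1 := rpow_mul_succ_rpow_one_sub_le ha0.le ha1.le hk'
  have hr2 := le_rpow_mul_succ_rpow_one_sub ha1.le hk'
  have hA0 : 0 ≤ binomialExp p k (fun s => (s : ℝ) ^ α) := by
    rw [← binomialExp_const p k 0]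
    exact binomialExp_mono h0 h1 _ fun s => by positivity
  set A := binomialExp p k (fun s => (s : ℝ) ^ α)
  set δ := binomialExp p k (fun s => ((s : ℝ) + 1) ^ α - (s : ℝ) ^ α)
  have hxk : ((k : ℝ) * p) ^ α ≤ k :=
    calc ((k : ℝ) * p) ^ α ≤ (k : ℝ) ^ α :=
          Real.rpow_le_rpow hx.le (mul_le_of_le_one_right hk'.le h1) ha0.le
      _ ≤ (k : ℝ) ^ (1 : ℝ) := Real.rpow_le_rpow_of_exponent_le hk1 ha1.le
      _ = k := Real.rpow_one _
  have hcp : (k : ℝ) ^ α * p ^ α = ((k : ℝ) * p) ^ α := (Real.mul_rpow hk'.le h0).symm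
  have hcb : (k : ℝ) ^ α * (k : ℝ) ^ (1 - α) = k := by rw [← Real.rpow_add hk']; simp
  -- after multiplication by `k ^ α`, everything is expressed through `ρ ∈ [0, 1 - α]`
  obtain ⟨ρ, hρ⟩ : ∃ ρ, ρ = (k : ℝ) ^ α * ((k : ℝ) + 1) ^ (1 - α) - k := ⟨_, rfl⟩
  have hmain : (((((k : ℝ) + 1) ^ (1 - α) - (k : ℝ) ^ (1 - α)) * A +
      ((k : ℝ) + 1) ^ (1 - α) * (p * δ) - p ^ α) * (k : ℝ) ^ α) =
      ρ * A + k * p * δ + ρ * (p * δ) - ((k : ℝ) * p) ^ α := by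
    rw [hρ]
    linear_combination (-A) * hcb - hcp
  rw [hmain]
  have hρ1 : ρ ≤ 1 - α := by linarith
  have hρ2 : (1 - α) * (k / (k + 1)) ≤ ρ := by linarith
  have hρ0 : 0 ≤ ρ :=
    le_trans (mul_nonneg (by linarith) (by positivity)) hρ2
  have hpd : 0 ≤ p * δ := mul_nonneg h0 hD3
  have hpd1 : p * δ ≤ 1 := mul_le_one₀ h1 hD3 hD4
  rw [abs_le]
  constructor
  · have h3 : (1 - α) * A - (1 - α) ≤ ρ * A := by
      have h4 := mul_le_mul_of_nonneg_right hρ2 hA0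
      have h5 : A - 1 ≤ k / (k + 1) * A := by
        have : (k : ℝ) / (k + 1) * A = A - A / (k + 1) := by field_simp; ring
        have h6 : A / ((k : ℝ) + 1) ≤ 1 := by
          rw [div_le_one (by positivity)]; linarith
        linarith
      have h7 := mul_le_mul_of_nonneg_left h5 (by linarith : 0 ≤ 1 - α)
      linarith
    have h8 := mul_le_mul_of_nonneg_left hA2 (by linarith : 0 ≤ 1 - α)
    have h9 := mul_nonneg hρ0 hpd
    linarith
  · have h3 := mul_le_mul hρ1 hA1 hA0 (by linarith)
    have h4 := mul_le_mul hρ1 hpd1 hpd (by linarith)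
    linarith

/-- For `p` well below `1 / k` the term `α * p ^ α` dominates and makes the bias negative. -/
theorem stepBias_rpow_le {α : ℝ} (ha0 : 0 < α) (ha1 : α < 1) {k : ℕ} (hk : 1 ≤ k) {p : ℝ}
    (hp : 0 < p) (h1 : p ≤ 1) :
    stepBias (fun x => x ^ α) p k ≤ ((k : ℝ) + 1) ^ (1 - α) * p - α * p ^ α := by
  have hk' : (0 : ℝ) < k := by exact_mod_cast hk
  have hx : 0 < (k : ℝ) * p := by positivity
  rw [stepBias_rpow hk]
  have hA1 := binomialExp_rpow_le ha0.le ha1.le hp.le h1 hx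
  have hD4 := binomialExp_rpow_succ_sub_le_one ha0.le ha1.le hp.le h1 k
  have hr1 := rpow_mul_succ_rpow_one_sub_le ha0.le ha1.le hk'
  have hcb : (k : ℝ) ^ α * (k : ℝ) ^ (1 - α) = k := by rw [← Real.rpow_add hk']; simp
  have hba : (k : ℝ) ^ (1 - α) ≤ ((k : ℝ) + 1) ^ (1 - α) :=
    Real.rpow_le_rpow hk'.le (by linarith) (by linarith)
  rw [Real.mul_rpow hk'.le hp.le] at hA1
  have h2 := mul_le_mul_of_nonneg_left hA1 (sub_nonneg.mpr hba)
  have h3 : (k : ℝ) ^ α * (((k : ℝ) + 1) ^ (1 - α) - (k : ℝ) ^ (1 - α)) ≤ 1 - α := by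
    rw [mul_sub, hcb]; linarith
  have h4 := mul_le_mul_of_nonneg_right h3 (Real.rpow_nonneg hp.le α)
  have h5 : ((k : ℝ) + 1) ^ (1 - α) * (p * binomialExp p k
      (fun s => ((s : ℝ) + 1) ^ α - (s : ℝ) ^ α)) ≤ ((k : ℝ) + 1) ^ (1 - α) * p := by
    gcongr
    exact mul_le_of_le_one_right hp.le hD4
  linarith

/-! ### Bounds on the bias norm -/

theorem biasNorm_entropy_le {K : ℝ} {n : ℕ} {m : Fin 2 → ℕ} (hm : IsSizes K n m) :
    biasNorm (fun p => -p * Real.log p) n m ≤ ENNReal.ofReal (2 * K / n) := by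
  have h1 := hm.one_le 0
  have hn : (0 : ℝ) < n := by exact_mod_cast h1.trans (hm.le_n 0)
  refine biasNorm_le _ hm fun p hp0 hp1 k hk _ =>
    (abs_stepBias_entropy_le (h1.trans hk) hp0 hp1).trans ?_
  have hm0 : (1 : ℝ) ≤ m 0 := by exact_mod_cast h1
  have hk' : (m 0 : ℝ) ≤ k := by exact_mod_cast hk
  have hK : 0 < K := pos_of_mul_pos_left (hn.trans_le (hm.n_le 0)) (by linarith)
  rw [div_le_div_iff₀ (by linarith) hn]
  nlinarith [hm.n_le 0, mul_le_mul_of_nonneg_left hk' hK.le]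

theorem biasNorm_rpow_le {α : ℝ} (ha0 : 0 < α) (ha1 : α < 1) {K : ℝ} {n : ℕ} {m : Fin 2 → ℕ}
    (hm : IsSizes K n m) :
    biasNorm (fun p => p ^ α) n m ≤ ENNReal.ofReal (2 * K / (n : ℝ) ^ α) := by
  have h1 := hm.one_le 0
  have hn : (0 : ℝ) < n := by exact_mod_cast h1.trans (hm.le_n 0)
  refine biasNorm_le _ hm fun p hp0 hp1 k hk _ =>
    (abs_stepBias_rpow_le ha0 ha1 (h1.trans hk) hp0 hp1).trans ?_
  have hm0 : (1 : ℝ) ≤ m 0 := by exact_mod_cast h1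
  have hk' : (m 0 : ℝ) ≤ k := by exact_mod_cast hk
  -- `m 0 ≤ n ≤ K * m 0` forces `1 ≤ K`, hence `K ^ α ≤ K`
  have hK : 1 ≤ K := by
    have h2 : (m 0 : ℝ) ≤ n := by exact_mod_cast hm.le_n 0
    have h3 := h2.trans (hm.n_le 0)
    by_contra! h
    nlinarith
  have hKα : K ^ α ≤ K := by
    simpa using Real.rpow_le_rpow_of_exponent_le hK ha1.le
  have hnk : (n : ℝ) ^ α ≤ K * (k : ℝ) ^ α :=
    calc (n : ℝ) ^ α ≤ (K * k) ^ α :=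
          Real.rpow_le_rpow hn.le ((hm.n_le 0).trans (by gcongr)) ha0.le
      _ = K ^ α * (k : ℝ) ^ α := Real.mul_rpow (by linarith) (by linarith)
      _ ≤ K * (k : ℝ) ^ α := by gcongr
  have hk0 : (0 : ℝ) < k := by linarith
  rw [div_le_div_iff₀ (by positivity) (by positivity)]
  linarith

/-- The bias at `p = e⁻² / n` is an average of terms that are all at most `-p`. -/
theorem le_biasNorm_entropy {K : ℝ} {n : ℕ} {m : Fin 2 → ℕ} (hm : IsSizes K n m) :
    ENNReal.ofReal (Real.exp (-2) / n) ≤ biasNorm (fun p => -p * Real.log p) n m := by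
  have hn1 : 1 ≤ n := (hm.one_le 0).trans (hm.le_n 0)
  have hn : (1 : ℝ) ≤ n := by exact_mod_cast hn1
  have hp : 0 < Real.exp (-2) / (n : ℝ) := by positivity
  have hp1 : Real.exp (-2) / (n : ℝ) ≤ 1 := by
    rw [div_le_one (by linarith)]
    exact (Real.exp_le_one_iff.mpr (by norm_num)).trans hn
  refine le_biasNorm _ hm hp.le hp1 fun k hk hk' =>
    (stepBias_entropy_le ((hm.one_le 0).trans hk) hp hp1).trans ?_
  have hkn : ((k : ℝ) + 1) ≤ n := by exact_mod_cast (Nat.succ_le_of_lt hk').trans (hm.le_n 1)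
  have hlog : Real.log (k + 1) ≤ Real.log n := Real.log_le_log (by positivity) hkn
  have hlp : Real.log (Real.exp (-2) / n) = -2 - Real.log n := by
    rw [Real.log_div (Real.exp_ne_zero _) (by linarith), Real.log_exp]
  rw [hlp]
  nlinarith

/-- The bias at `p = x / n` is an average of terms that are all at most `-x / n ^ α`, where `x = (α / 2) ^ (1 / (1 - α))` solves `α * x ^ α = 2 * x`. -/
theorem le_biasNorm_rpow {α : ℝ} (ha0 : 0 < α) (ha1 : α < 1) {K : ℝ} {n : ℕ} {m : Fin 2 → ℕ}
    (hm : IsSizes K n m) :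
    ENNReal.ofReal ((α / 2) ^ (1 / (1 - α)) / (n : ℝ) ^ α) ≤ biasNorm (fun p => p ^ α) n m := by
  have hn1 : 1 ≤ n := (hm.one_le 0).trans (hm.le_n 0)
  have hn : (1 : ℝ) ≤ n := by exact_mod_cast hn1
  have hb : 0 < 1 - α := by linarith
  obtain ⟨x, hx⟩ : ∃ x, x = (α / 2) ^ (1 / (1 - α)) := ⟨_, rfl⟩
  have hx0 : 0 < x := by rw [hx]; positivity
  have hx1 : x ≤ 1 := by
    rw [hx]; exact Real.rpow_le_one (by linarith) (by linarith) (by positivity)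
  have hxb : x ^ (1 - α) = α / 2 := by
    rw [hx, ← Real.rpow_mul (by linarith), one_div_mul_cancel hb.ne', Real.rpow_one]
  have hxα : α * x ^ α = 2 * x := by
    have : x ^ α * x ^ (1 - α) = x := by rw [← Real.rpow_add hx0]; simp
    rw [hxb] at this
    linarith
  rw [← hx]
  have hn0 : (0 : ℝ) < n := by linarith
  have hp : 0 < x / n := by positivity
  have hp1 : x / n ≤ 1 := by rw [div_le_one hn0]; linarith
  refine le_biasNorm _ hm hp.le hp1 fun k hk hk' =>
    (stepBias_rpow_le ha0 ha1 ((hm.one_le 0).trans hk) hp hp1).trans ?_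
  have hkn : ((k : ℝ) + 1) ≤ n := by exact_mod_cast (Nat.succ_le_of_lt hk').trans (hm.le_n 1)
  have h2 : ((k : ℝ) + 1) ^ (1 - α) * (x / n) ≤ (n : ℝ) ^ (1 - α) * (x / n) := by
    gcongr
  have h3 : (n : ℝ) ^ (1 - α) * (x / n) = x / (n : ℝ) ^ α := by
    rw [Real.rpow_sub hn0, Real.rpow_one]
    field_simp
  have h4 : α * (x / n) ^ α = 2 * x / (n : ℝ) ^ α := by
    rw [Real.div_rpow hx0.le hn0.le, ← mul_div_assoc, hxα]
  have h5 : 2 * x / (n : ℝ) ^ α = x / (n : ℝ) ^ α + x / (n : ℝ) ^ α := by ring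
  linarith

end Jackknife

theorem mainTheorem7 :
    -- upper bounds for every general 2-jackknife
    (∀ K : ℝ, 0 < K → ∃ C : ℝ, 0 < C ∧
      ∀ (n : ℕ) (m : Fin 2 → ℕ), Jackknife.IsSizes K n m →
        Jackknife.biasNorm (fun p => -p * Real.log p) n m ≤ ENNReal.ofReal (C / (n : ℝ))) ∧
    (∀ K : ℝ, 0 < K → ∃ C : ℝ, 0 < C ∧
      ∀ α : ℝ, 0 < α → α < 1 →
      ∀ (n : ℕ) (m : Fin 2 → ℕ), Jackknife.IsSizes K n m →
        Jackknife.biasNorm (fun p => p ^ α) n m ≤ ENNReal.ofReal (C / (n : ℝ) ^ α)) ∧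
    -- lower bounds for the delete-1 2-jackknife
    (∃ c : ℝ, 0 < c ∧
      ∀ (K : ℝ) (n : ℕ) (m : Fin 2 → ℕ), Jackknife.IsSizes K n m → Jackknife.IsDelete 1 n m →
        ENNReal.ofReal (c / (n : ℝ)) ≤ Jackknife.biasNorm (fun p => -p * Real.log p) n m) ∧
    (∀ α : ℝ, 0 < α → α < 1 → ∃ c : ℝ, 0 < c ∧
      ∀ (K : ℝ) (n : ℕ) (m : Fin 2 → ℕ), Jackknife.IsSizes K n m → Jackknife.IsDelete 1 n m →
        ENNReal.ofReal (c / (n : ℝ) ^ α) ≤ Jackknife.biasNorm (fun p => p ^ α) n m) ∧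
    -- lower bounds for every 2-jackknife with bounded coefficients
    (∀ B : ℝ, ∃ c : ℝ, 0 < c ∧
      ∀ (K : ℝ) (n : ℕ) (m : Fin 2 → ℕ), Jackknife.IsSizes K n m → Jackknife.BoundedCoeff B m →
        ENNReal.ofReal (c / (n : ℝ)) ≤ Jackknife.biasNorm (fun p => -p * Real.log p) n m) ∧
    (∀ (B α : ℝ), 0 < α → α < 1 → ∃ c : ℝ, 0 < c ∧
      ∀ (K : ℝ) (n : ℕ) (m : Fin 2 → ℕ), Jackknife.IsSizes K n m → Jackknife.BoundedCoeff B m →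
        ENNReal.ofReal (c / (n : ℝ) ^ α) ≤ Jackknife.biasNorm (fun p => p ^ α) n m) := by
  refine ⟨fun K hK => ⟨2 * K, by positivity, fun n m hm => Jackknife.biasNorm_entropy_le hm⟩,
    fun K hK => ⟨2 * K, by positivity, fun α h0 h1 n m hm => Jackknife.biasNorm_rpow_le h0 h1 hm⟩,
    ⟨Real.exp (-2), Real.exp_pos _, fun K n m hm _ => Jackknife.le_biasNorm_entropy hm⟩,
    fun α h0 h1 => ⟨(α / 2) ^ (1 / (1 - α)), by positivity,
      fun K n m hm _ => Jackknife.le_biasNorm_rpow h0 h1 hm⟩,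
    fun B => ⟨Real.exp (-2), Real.exp_pos _, fun K n m hm _ => Jackknife.le_biasNorm_entropy hm⟩,
    fun B α h0 h1 => ⟨(α / 2) ^ (1 / (1 - α)), by positivity,
      fun K n m hm _ => Jackknife.le_biasNorm_rpow h0 h1 hm⟩⟩
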